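/- Let $n\ge 1$ and let $H\subset\mathbb R^n$ be a Hanner polytope centered at the origin, that is, a full-dimensional polytope obtained, up to linear isomorphisms, from origin-symmetric line segments $[-a,a]\subset\mathbb R$, $a>0$, by finitely many applications of Cartesian products and of polarity $K\mapsto K^\circ=\{w:\langle w,x\rangle\le 1\ \text{for all } x\in K\}$. For a convex body $K\subset\mathbb R^n$ and distinct points $p,q$ in its interior, let $b$ be the point where the half-line from $p$ through $q$ meets $\partial K$, and let $d_K(p,q)=\log\frac{|pb|}{|qb|}$, $d_K(p,p)=0$, be the Funk distance. For $R>0$ let $B_K(R)=\{z\in\operatorname{int}K: d_K(0,z)\le R\}$ be the forward Funk ball about the origin (when $0\in\operatorname{int}K$). For a Borel set $U\subset \operatorname{int}K$ let $$\mathrm{vol}^{HT}_K(U)=\frac1{\omega_n}\int_U |(K-p)^\circ|\,dp$$ be its Holmes–Thompson volume, where $|\cdot|$ and $dp$ denote Lebesgue measure and $\omega_n$ is the volume of the $n$-dimensional Euclidean unit ball. Then, for every $R>0$ and with $\lambda=1-e^{-R}$, $$\mathrm{vol}^{HT}_H\big(B_H(R)\big)=\frac{2^n}{n!\,\omega_n}\left(\log\frac{1+\lambda}{1-\lambda}\right)^n=\frac{2^n}{n!\,\omega_n}\big(\log(2e^R-1)\big)^n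 .$$ -/

import Mathlib

open scoped ENNReal

noncomputable section

namespace Funk

/-- The polar body `K^p = (K - p)°` of `K ⊆ ℝⁿ` with respect to the point `p`; the dual of `ℝⁿ` is
identified with `ℝⁿ` through the standard dot product. The one-sided condition `≤ 1` is the right
one for bodies that are not symmetric about `p`. -/
def polarAt {n : ℕ} (K : Set (Fin n → ℝ)) (p : Fin n → ℝ) : Set (Fin n → ℝ) :=
  {w | ∀ x ∈ K, w ⬝ᵥ (x - p) ≤ 1}

/-- The Cartesian product `H × K ⊆ ℝᵐ⁺ⁿ` of `H ⊆ ℝᵐ` and `K ⊆ ℝⁿ`. -/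
def cartesianProduct {m n : ℕ} (H : Set (Fin m → ℝ)) (K : Set (Fin n → ℝ)) :
    Set (Fin (m + n) → ℝ) :=
  {z | (fun i : Fin m => z (Fin.castAdd n i)) ∈ H ∧ (fun j : Fin n => z (Fin.natAdd m j)) ∈ K}

/-- `IsHanner n H`: the set `H` is an `n`-dimensional Hanner polytope in `ℝⁿ` centered at the
origin, that is, `H` is built from centered nondegenerate line segments by Cartesian products and
polar bodies. The rule `linearImage` makes the notion independent of the choice of linear
coordinates on `ℝⁿ`. -/
inductive IsHanner : (n : ℕ) → Set (Fin n → ℝ) → Prop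
  | lineSegment (v : Fin 1 → ℝ) (hv : v ≠ 0) : IsHanner 1 (segment ℝ (-v) v)
  | product {m n : ℕ} {H : Set (Fin m → ℝ)} {K : Set (Fin n → ℝ)} :
      IsHanner m H → IsHanner n K → IsHanner (m + n) (cartesianProduct H K)
  | polar {n : ℕ} {H : Set (Fin n → ℝ)} : IsHanner n H → IsHanner n (polarAt H 0)
  | linearImage {n : ℕ} {H : Set (Fin n → ℝ)} (A : (Fin n → ℝ) ≃ₗ[ℝ] (Fin n → ℝ)) :
      IsHanner n H → IsHanner n (A '' H)

/-- For a convex body `K`, a point `p` in its interior and `v ≠ 0`, the unique `t > 0` such that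
`p + t v` lies on the boundary of `K` (so that the Funk norm of `v` at `p` is `1 / t`). -/
def exitTime {n : ℕ} (K : Set (Fin n → ℝ)) (p v : Fin n → ℝ) : ℝ :=
  sInf {t : ℝ | 0 < t ∧ p + t • v ∈ frontier K}

open Classical in
/-- The Funk distance `d_K(p, q) = log (pb / qb)`, where `b = p + t (q - p)` is the point at which
the half line from `p` through `q` meets the boundary of `K`; as `b - p = t (q - p)` and
`b - q = (t - 1) (q - p)`, the ratio `pb / qb` is `t / (t - 1)`. Moreover `d_K(p, p) = 0`. -/
def funkDist {n : ℕ} (K : Set (Fin n → ℝ)) (p q : Fin n → ℝ) : ℝ :=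
  if p = q then 0
  else Real.log (exitTime K p (q - p) / (exitTime K p (q - p) - 1))

/-- The forward Funk metric ball of radius `R` about `p`, in the Funk geometry on the interior
of `K`. -/
def funkBall {n : ℕ} (K : Set (Fin n → ℝ)) (p : Fin n → ℝ) (R : ℝ) : Set (Fin n → ℝ) :=
  {z | z ∈ interior K ∧ funkDist K p z ≤ R}

/-- `ω_n`, the Lebesgue volume of the Euclidean unit ball of `ℝⁿ`. -/
def omega (n : ℕ) : ℝ :=
  (MeasureTheory.volume (Metric.ball (0 : EuclideanSpace ℝ (Fin n)) 1)).toReal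

/-- The Holmes-Thompson volume `∫_U |K^p| / ω_n dp` of the Funk geometry of `K`. -/
def volHT {n : ℕ} (K U : Set (Fin n → ℝ)) : ℝ≥0∞ :=
  ∫⁻ p in U, MeasureTheory.volume (polarAt K p) / ENNReal.ofReal (omega n)

end Funk

end

/-!
Put `h_K(w) = sup {⟨w, x⟩ | x ∈ K}`. For `p ∈ K` the polar `K^p` is the sublevel set at `1` of the
nonnegative, positively homogeneous function `w ↦ h_K(w) - ⟨w, p⟩`, so integrating
`exp (-(h_K(w) - ⟨w, p⟩))` over its sublevel sets gives `n! |K^p| = ∫ exp (⟨w, p⟩ - h_K(w)) dw`.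
Since support functions add up on Cartesian products, `n! ∫_U |K^p| dp` is multiplicative there.

Slicing the same integral along the sublevel sets `r K°` of `h_K` alone turns `n! ∫_{c K} |K^p| dp`
into `cⁿ ∫₀^∞ rⁿ e^{-r} ∫_K ∫_{K°} exp (r c ⟨w, p⟩) dw dp dr`, which is symmetric in `K` and `K°`.
Linear invariance is a change of variables. Hence for a Hanner polytope the integral is the `n`-th
power of its value for `[-1, 1]`, where `|K^p| = 1 / (1 - p) + 1 / (1 + p)`. Finally, `d_K(0, z)` is
`-log (1 - ‖z‖_K)` for the gauge `‖·‖_K`, so the forward Funk ball is the dilate `(1 - e^{-R}) K`.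
-/

namespace Funk

open MeasureTheory Set Bornology
open scoped Topology Pointwise

section Polar

variable {n : ℕ} {K : Set (Fin n → ℝ)} {p w : Fin n → ℝ}

theorem mem_polarAt_zero : w ∈ polarAt K 0 ↔ ∀ x ∈ K, w ⬝ᵥ x ≤ 1 := by
  simp [polarAt]

theorem isClosed_setOf_mem_polarAt (K : Set (Fin n → ℝ)) :
    IsClosed {q : (Fin n → ℝ) × (Fin n → ℝ) | q.2 ∈ polarAt K q.1} := by
  have hset : {q : (Fin n → ℝ) × (Fin n → ℝ) | q.2 ∈ polarAt K q.1} =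
      ⋂ x ∈ K, {q | q.2 ⬝ᵥ (x - q.1) ≤ 1} := by
    ext q
    simp only [polarAt, mem_ofPred_eq, mem_iInter]
  rw [hset]
  exact isClosed_biInter fun x _ =>
    isClosed_le (continuous_snd.dotProduct (continuous_const.sub continuous_fst)) continuous_const

theorem measurable_volume_polarAt (K : Set (Fin n → ℝ)) :
    Measurable fun p => volume (polarAt K p) :=
  measurable_measure_prodMk_left (isClosed_setOf_mem_polarAt K).measurableSet

theorem isClosed_polarAt (K : Set (Fin n → ℝ)) (p : Fin n → ℝ) : IsClosed (polarAt K p) :=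
  (isClosed_setOf_mem_polarAt K).preimage (Continuous.prodMk_right p)

theorem convex_polarAt (K : Set (Fin n → ℝ)) (p : Fin n → ℝ) : Convex ℝ (polarAt K p) := by
  simp only [polarAt, ofPred_forall]
  exact convex_iInter₂ fun x _ =>
    convex_halfSpace_le ⟨fun u v => add_dotProduct u v _, fun c u => smul_dotProduct c u _⟩ 1

theorem isBounded_polarAt (hK : K ∈ 𝓝 p) : IsBounded (polarAt K p) := by
  obtain ⟨ε, hε, hεK⟩ := Metric.nhds_basis_closedBall.mem_iff.1 hK
  refine isBounded_iff_forall_norm_le.2 ⟨ε⁻¹, fun w hw => ?_⟩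
  refine (pi_norm_le_iff_of_nonneg (by positivity)).2 fun i => ?_
  have coord_mul_le (c : ℝ) (hc : |c| ≤ ε) : w i * c ≤ 1 := by
    have h := hw (p + Pi.single i c) (hεK (by simpa [Pi.norm_single] using hc))
    rwa [add_sub_cancel_left, dotProduct_single] at h
  rw [Real.norm_eq_abs, ← one_div, abs_le, neg_le, le_div_iff₀ hε, le_div_iff₀ hε, neg_mul,
    ← mul_neg]
  exact ⟨coord_mul_le (-ε) (by rw [abs_neg, abs_of_pos hε]), coord_mul_le ε (abs_of_pos hε).le⟩

theorem polarAt_mem_nhds_zero (hK : IsBounded K) (p : Fin n → ℝ) : polarAt K p ∈ 𝓝 0 := by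
  have eventually_dotProduct_le (x : Fin n → ℝ) :
      ∀ᶠ q : (Fin n → ℝ) × (Fin n → ℝ) in 𝓝 (0, x), q.1 ⬝ᵥ (q.2 - p) ≤ 1 :=
    (continuous_fst.dotProduct (continuous_snd.sub continuous_const)).continuousAt.eventually
      (ge_mem_nhds (by simp))
  filter_upwards [hK.isCompact_closure.eventually_forall_of_forall_eventually
    (P := fun w x => w ⬝ᵥ (x - p) ≤ 1) fun x _ => eventually_dotProduct_le x]
    with w hw x hx using hw x (subset_closure hx)

theorem polarAt_polarAt_zero (hconv : Convex ℝ K) (hclosed : IsClosed K) (h0 : 0 ∈ K) :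
    polarAt (polarAt K 0) 0 = K := by
  refine Subset.antisymm (fun x hx => ?_) fun x hx => mem_polarAt_zero.2 fun w hw =>
    dotProduct_comm x w ▸ mem_polarAt_zero.1 hw x hx
  by_contra hxK
  obtain ⟨f, u, hf, hu⟩ := geometric_hahn_banach_closed_point hconv hclosed hxK
  have hu0 : 0 < u := by simpa using hf 0 h0
  obtain ⟨w, hw⟩ := (dotProductEquiv ℝ (Fin n)).surjective f.toLinearMap
  have f_eq (y : Fin n → ℝ) : w ⬝ᵥ y = f y := LinearMap.congr_fun hw y
  have hwK : u⁻¹ • w ∈ polarAt K 0 := mem_polarAt_zero.2 fun y hy => by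
    rw [smul_dotProduct, f_eq, smul_eq_mul, inv_mul_le_one₀ hu0]
    exact (hf y hy).le
  have hux : u⁻¹ * f x ≤ 1 := by
    simpa only [dotProduct_comm x, smul_dotProduct, f_eq, smul_eq_mul]
      using mem_polarAt_zero.1 hx _ hwK
  exact (((inv_mul_le_one₀ hu0).1 hux).trans_lt hu).false

theorem polarAt_image {m : ℕ} (A : (Fin n → ℝ) →ₗ[ℝ] (Fin m → ℝ)) (K : Set (Fin n → ℝ))
    (p : Fin n → ℝ) :
    polarAt (A '' K) (A p) = Matrix.toLin' (LinearMap.toMatrix' A).transpose ⁻¹' polarAt K p := by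
  have dotProduct_apply (w : Fin m → ℝ) (x : Fin n → ℝ) :
      w ⬝ᵥ A x = Matrix.toLin' (LinearMap.toMatrix' A).transpose w ⬝ᵥ x := by
    rw [Matrix.toLin'_apply, Matrix.mulVec_transpose, ← Matrix.dotProduct_mulVec,
      LinearMap.toMatrix'_mulVec]
  ext w
  simp only [polarAt, mem_ofPred_eq, mem_preimage, forall_mem_image, ← map_sub, dotProduct_apply]

theorem volume_polarAt_image (A : (Fin n → ℝ) ≃ₗ[ℝ] (Fin n → ℝ)) (K : Set (Fin n → ℝ))
    (p : Fin n → ℝ) :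
    ENNReal.ofReal |LinearMap.det A.toLinearMap| * volume (polarAt (A '' K) (A p)) =
      volume (polarAt K p) := by
  have hdet : LinearMap.det A.toLinearMap ≠ 0 := A.isUnit_det'.ne_zero
  have hdetT : LinearMap.det (Matrix.toLin' (LinearMap.toMatrix' A.toLinearMap).transpose) =
      LinearMap.det A.toLinearMap := by
    rw [LinearMap.det_toLin', Matrix.det_transpose, LinearMap.det_toMatrix']
  have himage : polarAt (A '' K) (A p) =
      Matrix.toLin' (LinearMap.toMatrix' A.toLinearMap).transpose ⁻¹' polarAt K p :=
    polarAt_image A.toLinearMap K p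
  rw [himage, Measure.addHaar_preimage_linearMap volume (by rwa [hdetT]), hdetT, ← mul_assoc,
    ← ENNReal.ofReal_mul (abs_nonneg _), ← abs_mul, mul_inv_cancel₀ hdet, abs_one,
    ENNReal.ofReal_one, one_mul]

end Polar

section SupportFunction

variable {m n : ℕ} {K : Set (Fin n → ℝ)} {p w : Fin n → ℝ}

/-- The support function `h_K(w) = sup {w ⬝ᵥ x | x ∈ K}` of a bounded nonempty set `K`. As a
supremum of reals, it is `0` by convention when `K` is empty or `w` is unbounded above on `K`. -/
noncomputable def supportFun (K : Set (Fin n → ℝ)) (w : Fin n → ℝ) : ℝ := sSup ((w ⬝ᵥ ·) '' K)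

theorem bddAbove_dotProduct_image (hK : IsBounded K) (w : Fin n → ℝ) :
    BddAbove ((w ⬝ᵥ ·) '' K) :=
  (hK.isCompact_closure.bddAbove_image
    (continuous_const.dotProduct continuous_id).continuousOn).mono (image_mono subset_closure)

theorem supportFun_le_iff (hK : IsBounded K) (hne : K.Nonempty) {r : ℝ} :
    supportFun K w ≤ r ↔ ∀ x ∈ K, w ⬝ᵥ x ≤ r := by
  rw [supportFun, csSup_le_iff (bddAbove_dotProduct_image hK w) (hne.image _), forall_mem_image]

theorem dotProduct_le_supportFun (hK : IsBounded K) (hp : p ∈ K) (w : Fin n → ℝ) :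
    w ⬝ᵥ p ≤ supportFun K w :=
  le_csSup (bddAbove_dotProduct_image hK w) (mem_image_of_mem _ hp)

theorem supportFun_smul (K : Set (Fin n → ℝ)) {r : ℝ} (hr : 0 ≤ r) (w : Fin n → ℝ) :
    supportFun K (r • w) = r * supportFun K w := by
  simp only [supportFun, smul_dotProduct, ← smul_eq_mul, ← Real.sSup_smul_of_nonneg hr,
    ← image_smul, image_image]

theorem measurable_supportFun (hK : IsBounded K) (hne : K.Nonempty) :
    Measurable (supportFun K) := by
  refine measurable_of_Iic fun r => IsClosed.measurableSet ?_
  simp only [preimage, mem_Iic, supportFun_le_iff hK hne, ofPred_forall]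
  exact isClosed_biInter fun x _ =>
    isClosed_le (continuous_id.dotProduct continuous_const) continuous_const

theorem mem_polarAt_iff_supportFun (hK : IsBounded K) (hne : K.Nonempty) :
    w ∈ polarAt K p ↔ supportFun K w - w ⬝ᵥ p ≤ 1 := by
  rw [sub_le_iff_le_add, supportFun_le_iff hK hne]
  simp only [polarAt, mem_ofPred_eq, dotProduct_sub, sub_le_iff_le_add]

theorem append_mem_cartesianProduct {H : Set (Fin m → ℝ)} {x : Fin m → ℝ} {y : Fin n → ℝ} :
    Fin.append x y ∈ cartesianProduct H K ↔ x ∈ H ∧ y ∈ K := by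
  simp [cartesianProduct]

theorem append_dotProduct_append (u x : Fin m → ℝ) (w y : Fin n → ℝ) :
    Fin.append u w ⬝ᵥ Fin.append x y = u ⬝ᵥ x + w ⬝ᵥ y := by
  simp [dotProduct, Fin.sum_univ_add]

theorem cartesianProduct_eq_image (H : Set (Fin m → ℝ)) (K : Set (Fin n → ℝ)) :
    cartesianProduct H K = Fin.appendHomeomorph m n '' (H ×ˢ K) :=
  ((Fin.appendEquiv m n).image_eq_preimage_symm (H ×ˢ K)).symm

theorem isBounded_cartesianProduct {H : Set (Fin m → ℝ)} (hH : IsBounded H) (hK : IsBounded K) :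
    IsBounded (cartesianProduct H K) := by
  rw [cartesianProduct_eq_image]
  exact (Fin.appendIsometry m n).isometry.lipschitz.isBounded_image (hH.prod hK)

theorem supportFun_cartesianProduct {H : Set (Fin m → ℝ)} (hH : IsBounded H) (hH₀ : H.Nonempty)
    (hK : IsBounded K) (hK₀ : K.Nonempty) (u : Fin m → ℝ) (w : Fin n → ℝ) :
    supportFun (cartesianProduct H K) (Fin.append u w) = supportFun H u + supportFun K w := by
  have himage : (Fin.append u w ⬝ᵥ ·) '' cartesianProduct H K =
      (u ⬝ᵥ ·) '' H + (w ⬝ᵥ ·) '' K := by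
    rw [cartesianProduct_eq_image, image_image, ← image2_add, image2_image_left,
      image2_image_right, ← image_uncurry_prod]
    exact image_congr fun q _ => append_dotProduct_append u q.1 w q.2
  rw [supportFun, himage, csSup_add (hH₀.image _) (bddAbove_dotProduct_image hH u)
    (hK₀.image _) (bddAbove_dotProduct_image hK w)]
  rfl

end SupportFunction

section HomogeneousSlicing

theorem setLIntegral_Ioi_indicator_Ici_exp_neg {t : ℝ} (ht : 0 ≤ t) :
    ∫⁻ r in Ioi (0 : ℝ), (Ici t).indicator (fun r => ENNReal.ofReal (Real.exp (-r))) r =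
      ENNReal.ofReal (Real.exp (-t)) := by
  have hae : (Ici t ∩ Ioi 0 : Set ℝ) =ᵐ[volume] Ioi t := by
    rw [← inter_eq_left.2 (Ioi_subset_Ioi ht)]
    exact Ioi_ae_eq_Ici.symm.inter (ae_eq_refl _)
  rw [lintegral_indicator measurableSet_Ici, Measure.restrict_restrict measurableSet_Ici,
    Measure.restrict_congr_set hae, ← ofReal_integral_eq_lintegral_ofReal
      (integrableOn_exp_neg_Ioi t) (ae_of_all _ fun _ => (Real.exp_pos _).le),
    integral_exp_neg_Ioi]

theorem setLIntegral_Ioi_pow_mul_exp_neg (n : ℕ) :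
    ∫⁻ r in Ioi (0 : ℝ), ENNReal.ofReal (r ^ n * Real.exp (-r)) = n.factorial := by
  have hpos : (0 : ℝ) < n + 1 := by positivity
  have heq : EqOn (fun r : ℝ => Real.exp (-r) * r ^ ((n : ℝ) + 1 - 1))
      (fun r => r ^ n * Real.exp (-r)) (Ioi 0) := fun r _ => by
    simp only [add_sub_cancel_right, Real.rpow_natCast, mul_comm]
  have hint := (integrableOn_congr_fun heq measurableSet_Ioi).1 (Real.GammaIntegral_convergent hpos)
  have hnonneg : ∀ᵐ r : ℝ ∂volume.restrict (Ioi 0), 0 ≤ r ^ n * Real.exp (-r) :=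
    ae_restrict_of_forall_mem measurableSet_Ioi fun r (hr : 0 < r) => by positivity
  rw [← ofReal_integral_eq_lintegral_ofReal hint hnonneg,
    ← setIntegral_congr_fun measurableSet_Ioi heq,
    ← Real.Gamma_eq_integral hpos, Real.Gamma_nat_eq_factorial, ENNReal.ofReal_natCast]

theorem setOf_le_eq_smul_setOf_le_one {E : Type*} [AddCommGroup E] [Module ℝ E] {h : E → ℝ}
    (hhom : ∀ r, 0 < r → ∀ x, h (r • x) = r * h x) {r : ℝ} (hr : 0 < r) :
    {x | h x ≤ r} = r • {x | h x ≤ 1} := by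
  ext x
  rw [mem_smul_set_iff_inv_smul_mem₀ hr.ne', mem_ofPred_eq, mem_ofPred_eq,
    hhom _ (inv_pos.2 hr), inv_mul_le_one₀ hr]

variable {E : Type*} [NormedAddCommGroup E] [NormedSpace ℝ E] [FiniteDimensional ℝ E]
  [MeasurableSpace E] [BorelSpace E] (μ : Measure E) [μ.IsAddHaarMeasure]

theorem setLIntegral_image_linearEquiv (A : E ≃ₗ[ℝ] E) {s : Set E} (hs : MeasurableSet s)
    (f : E → ℝ≥0∞) :
    ∫⁻ x in A '' s, f x ∂μ =
      ENNReal.ofReal |LinearMap.det A.toLinearMap| * ∫⁻ x in s, f (A x) ∂μ := by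
  rw [← lintegral_const_mul' _ _ ENNReal.ofReal_ne_top]
  exact lintegral_image_eq_lintegral_abs_det_fderiv_mul μ hs
    (fun _ _ => A.toContinuousLinearEquiv.hasFDerivAt.hasFDerivWithinAt) A.injective.injOn f

theorem setLIntegral_smul_set {r : ℝ} (hr : 0 < r) {s : Set E} (hs : MeasurableSet s)
    (f : E → ℝ≥0∞) :
    ∫⁻ x in r • s, f x ∂μ =
      ENNReal.ofReal (r ^ Module.finrank ℝ E) * ∫⁻ x in s, f (r • x) ∂μ := by
  have hdet : LinearMap.det (LinearEquiv.smulOfNeZero ℝ E r hr.ne').toLinearMap =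
      r ^ Module.finrank ℝ E := by
    have : (LinearEquiv.smulOfNeZero ℝ E r hr.ne').toLinearMap = r • LinearMap.id := rfl
    rw [this, LinearMap.det_smul, LinearMap.det_id, mul_one]
  have h := setLIntegral_image_linearEquiv μ (LinearEquiv.smulOfNeZero ℝ E r hr.ne') hs f
  rwa [hdet, abs_of_pos (pow_pos hr _)] at h

variable {h : E → ℝ} {g : E → ℝ≥0∞}

theorem lintegral_exp_neg_mul_of_homogeneous (hmeas : Measurable h) (hnonneg : ∀ x, 0 ≤ h x)
    (hhom : ∀ r, 0 < r → ∀ x, h (r • x) = r * h x) (hg : Measurable g) :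
    ∫⁻ x, ENNReal.ofReal (Real.exp (-h x)) * g x ∂μ =
      ∫⁻ r in Ioi (0 : ℝ), ENNReal.ofReal (r ^ Module.finrank ℝ E * Real.exp (-r)) *
        ∫⁻ x in {x | h x ≤ 1}, g (r • x) ∂μ := by
  have hle (r : ℝ) : MeasurableSet {x | h x ≤ r} := measurableSet_le hmeas measurable_const
  have hF : Measurable fun q : E × ℝ =>
      {q : E × ℝ | h q.1 ≤ q.2}.indicator (fun q => ENNReal.ofReal (Real.exp (-q.2))) q * g q.1 :=
    (Measurable.indicator (by fun_prop) (measurableSet_le (by fun_prop) measurable_snd)).mul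
      (by fun_prop)
  calc ∫⁻ x, ENNReal.ofReal (Real.exp (-h x)) * g x ∂μ
      = ∫⁻ x, (∫⁻ r in Ioi (0 : ℝ),
          (Ici (h x)).indicator (fun r => ENNReal.ofReal (Real.exp (-r))) r * g x) ∂μ := by
        refine lintegral_congr fun x => ?_
        rw [lintegral_mul_const _ (Measurable.indicator (by fun_prop) measurableSet_Ici),
          setLIntegral_Ioi_indicator_Ici_exp_neg (hnonneg x)]
    _ = ∫⁻ r in Ioi (0 : ℝ), ∫⁻ x,
          (Ici (h x)).indicator (fun r => ENNReal.ofReal (Real.exp (-r))) r * g x ∂μ :=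
        lintegral_lintegral_swap hF.aemeasurable
    _ = ∫⁻ r in Ioi (0 : ℝ), ENNReal.ofReal (Real.exp (-r)) * ∫⁻ x in {x | h x ≤ r}, g x ∂μ := by
        refine lintegral_congr fun r => ?_
        rw [← lintegral_const_mul' _ _ ENNReal.ofReal_ne_top, ← lintegral_indicator (hle r)]
        refine lintegral_congr fun x => ?_
        simp only [indicator, mem_Ici, mem_ofPred_eq, ite_mul, zero_mul]
    _ = _ := by
        refine setLIntegral_congr_fun measurableSet_Ioi fun r hr => ?_
        rw [setOf_le_eq_smul_setOf_le_one hhom hr, setLIntegral_smul_set μ hr (hle 1), ← mul_assoc,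
          ← ENNReal.ofReal_mul (Real.exp_pos _).le, mul_comm (Real.exp _)]

end HomogeneousSlicing

section PolarVolume

variable {m n : ℕ} {K : Set (Fin n → ℝ)} {p : Fin n → ℝ}

theorem factorial_mul_volume_polarAt (hK : IsBounded K) (hp : p ∈ K) :
    n.factorial * volume (polarAt K p) =
      ∫⁻ w, ENNReal.ofReal (Real.exp (w ⬝ᵥ p - supportFun K w)) := by
  have hpolar : {w | supportFun K w - w ⬝ᵥ p ≤ 1} = polarAt K p := by
    ext w
    exact (mem_polarAt_iff_supportFun hK ⟨p, hp⟩).symm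
  have hslice := lintegral_exp_neg_mul_of_homogeneous volume
    (h := fun w => supportFun K w - w ⬝ᵥ p) (g := 1)
    ((measurable_supportFun hK ⟨p, hp⟩).sub
      (continuous_id.dotProduct continuous_const).measurable)
    (fun w => sub_nonneg.2 (dotProduct_le_supportFun hK hp w))
    (fun r hr w => by rw [supportFun_smul K hr.le, smul_dotProduct, smul_eq_mul, mul_sub])
    measurable_one
  simp only [neg_sub, Pi.one_apply, mul_one, hpolar, setLIntegral_one, Module.finrank_fin_fun]
    at hslice
  rw [hslice, lintegral_mul_const _ (by fun_prop), setLIntegral_Ioi_pow_mul_exp_neg]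

theorem factorial_mul_volume_polarAt_eq_slice (hK : IsBounded K) (h0 : 0 ∈ K) (hp : p ∈ K) :
    n.factorial * volume (polarAt K p) =
      ∫⁻ r in Ioi (0 : ℝ), ENNReal.ofReal (r ^ n * Real.exp (-r)) *
        ∫⁻ x in polarAt K 0, ENNReal.ofReal (Real.exp (r * (x ⬝ᵥ p))) := by
  have hpolar : {w | supportFun K w ≤ 1} = polarAt K 0 := by
    ext w
    rw [mem_polarAt_iff_supportFun hK ⟨0, h0⟩, dotProduct_zero, sub_zero, mem_ofPred_eq]
  have hslice := lintegral_exp_neg_mul_of_homogeneous volume (h := supportFun K)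
    (g := fun w => ENNReal.ofReal (Real.exp (w ⬝ᵥ p))) (measurable_supportFun hK ⟨0, h0⟩)
    (fun w => dotProduct_zero w ▸ dotProduct_le_supportFun hK h0 w)
    (fun r hr w => supportFun_smul K hr.le w)
    (Real.continuous_exp.comp
      (continuous_id.dotProduct continuous_const)).measurable.ennreal_ofReal
  simp only [hpolar, Module.finrank_fin_fun, smul_dotProduct, smul_eq_mul] at hslice
  rw [factorial_mul_volume_polarAt hK hp, ← hslice]
  refine lintegral_congr fun w => ?_
  rw [← ENNReal.ofReal_mul (Real.exp_pos _).le, ← Real.exp_add, neg_add_eq_sub]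

theorem volume_preserving_append :
    MeasurePreserving (Fin.appendHomeomorph (X := ℝ) m n).toMeasurableEquiv volume volume := by
  have hsum := volume_measurePreserving_sumPiEquivProdPi_symm fun _ : Fin m ⊕ Fin n => ℝ
  have hcongr := volume_measurePreserving_piCongrLeft (fun _ : Fin (m + n) => ℝ) finSumFinEquiv
  convert! hcongr.comp hsum using 1
  ext q i
  refine Fin.addCases (fun j => ?_) (fun j => ?_) i
  · exact (Fin.append_left q.1 q.2 j).trans
      (Equiv.piCongrLeft_sumInl (fun _ => ℝ) finSumFinEquiv q.1 q.2 j).symm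
  · exact (Fin.append_right q.1 q.2 j).trans
      (Equiv.piCongrLeft_sumInr (fun _ => ℝ) finSumFinEquiv q.1 q.2 j).symm

theorem setLIntegral_cartesianProduct (S : Set (Fin m → ℝ)) (T : Set (Fin n → ℝ))
    (f : (Fin (m + n) → ℝ) → ℝ≥0∞) :
    ∫⁻ z in cartesianProduct S T, f z = ∫⁻ q in S ×ˢ T, f (Fin.append q.1 q.2) := by
  rw [cartesianProduct_eq_image]
  exact (volume_preserving_append.setLIntegral_comp_emb
    (Fin.appendHomeomorph m n).toMeasurableEquiv.measurableEmbedding f _).symm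

theorem factorial_mul_volume_polarAt_cartesianProduct {H : Set (Fin m → ℝ)} (hH : IsBounded H)
    (hK : IsBounded K) {x : Fin m → ℝ} (hx : x ∈ H) (hp : p ∈ K) :
    (m + n).factorial * volume (polarAt (cartesianProduct H K) (Fin.append x p)) =
      (m.factorial * volume (polarAt H x)) * (n.factorial * volume (polarAt K p)) := by
  have hmeas {k : ℕ} {L : Set (Fin k → ℝ)} {y : Fin k → ℝ} (hL : IsBounded L) (hy : y ∈ L) :
      Measurable fun w => ENNReal.ofReal (Real.exp (w ⬝ᵥ y - supportFun L w)) :=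
    (Real.measurable_exp.comp ((continuous_id.dotProduct continuous_const).measurable.sub
      (measurable_supportFun hL ⟨y, hy⟩))).ennreal_ofReal
  have huniv : cartesianProduct (univ : Set (Fin m → ℝ)) (univ : Set (Fin n → ℝ)) = univ := by
    simp only [cartesianProduct, mem_univ, and_self, ofPred_true]
  rw [factorial_mul_volume_polarAt hH hx, factorial_mul_volume_polarAt hK hp,
    factorial_mul_volume_polarAt (isBounded_cartesianProduct hH hK)
      (append_mem_cartesianProduct.2 ⟨hx, hp⟩),
    ← lintegral_prod_mul (hmeas hH hx).aemeasurable (hmeas hK hp).aemeasurable,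
    ← setLIntegral_univ, ← huniv, setLIntegral_cartesianProduct, univ_prod_univ, setLIntegral_univ,
    ← Measure.volume_eq_prod]
  refine lintegral_congr fun q => ?_
  rw [append_dotProduct_append, supportFun_cartesianProduct hH ⟨x, hx⟩ hK ⟨p, hp⟩,
    ← ENNReal.ofReal_mul (Real.exp_pos _).le, ← Real.exp_add, add_sub_add_comm]

end PolarVolume

section ConvexBody

variable {m n : ℕ} {K : Set (Fin n → ℝ)}

/-- A convex body of `ℝⁿ` with the origin in its interior; polarity is an involution of this
class. -/
structure IsConvexBody (K : Set (Fin n → ℝ)) : Prop where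
  convex : Convex ℝ K
  isCompact : IsCompact K
  mem_nhds_zero : K ∈ 𝓝 0

namespace IsConvexBody

theorem zero_mem (hK : IsConvexBody K) : 0 ∈ K :=
  mem_of_mem_nhds hK.mem_nhds_zero

theorem measurableSet (hK : IsConvexBody K) : MeasurableSet K :=
  hK.isCompact.isClosed.measurableSet

theorem smul_subset (hK : IsConvexBody K) {c : ℝ} (h0 : 0 ≤ c) (h1 : c ≤ 1) : c • K ⊆ K := by
  rintro _ ⟨x, hx, rfl⟩
  exact hK.convex.smul_mem_of_zero_mem hK.zero_mem hx ⟨h0, h1⟩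

theorem polarAt_zero (hK : IsConvexBody K) : IsConvexBody (polarAt K 0) where
  convex := convex_polarAt K 0
  isCompact := Metric.isCompact_of_isClosed_isBounded (isClosed_polarAt K 0)
    (isBounded_polarAt hK.mem_nhds_zero)
  mem_nhds_zero := polarAt_mem_nhds_zero hK.isCompact.isBounded 0

theorem image (hK : IsConvexBody K) (A : (Fin n → ℝ) ≃ₗ[ℝ] (Fin n → ℝ)) :
    IsConvexBody (A '' K) where
  convex := hK.convex.linear_image A.toLinearMap
  isCompact := hK.isCompact.image A.toContinuousLinearEquiv.continuous
  mem_nhds_zero := by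
    have h := A.toContinuousLinearEquiv.toHomeomorph.isOpenMap.image_mem_nhds hK.mem_nhds_zero
    rwa [show A.toContinuousLinearEquiv.toHomeomorph 0 = 0 from map_zero A] at h

theorem cartesianProduct {H : Set (Fin m → ℝ)} (hH : IsConvexBody H) (hK : IsConvexBody K) :
    IsConvexBody (cartesianProduct H K) where
  convex := (hH.convex.linear_preimage (LinearMap.funLeft ℝ ℝ (Fin.castAdd n))).inter
    (hK.convex.linear_preimage (LinearMap.funLeft ℝ ℝ (Fin.natAdd m)))
  isCompact := cartesianProduct_eq_image H K ▸
    (hH.isCompact.prod hK.isCompact).image (Fin.appendHomeomorph m n).continuous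
  mem_nhds_zero := Filter.inter_mem
    ((LinearMap.funLeft ℝ ℝ (Fin.castAdd n)).continuous_of_finiteDimensional.continuousAt
      (by simpa using hH.mem_nhds_zero))
    ((LinearMap.funLeft ℝ ℝ (Fin.natAdd m)).continuous_of_finiteDimensional.continuousAt
      (by simpa using hK.mem_nhds_zero))

end IsConvexBody

end ConvexBody

section HolmesThompson

variable {m n : ℕ} {K U : Set (Fin n → ℝ)}

/-- The Holmes-Thompson volume rescaled to `n! ∫_U |K^p| dp`, the normalization that makes it
multiplicative under Cartesian products. -/
noncomputable def normalizedVolHT (K U : Set (Fin n → ℝ)) : ℝ≥0∞ :=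
  n.factorial * ∫⁻ p in U, volume (polarAt K p)

theorem omega_pos (n : ℕ) : 0 < omega n :=
  ENNReal.toReal_pos (Metric.measure_ball_pos _ _ one_pos).ne' measure_ball_lt_top.ne

theorem volHT_eq_normalizedVolHT_div (K U : Set (Fin n → ℝ)) :
    volHT K U = normalizedVolHT K U / ENNReal.ofReal (n.factorial * omega n) := by
  rw [normalizedVolHT, ENNReal.ofReal_mul n.factorial.cast_nonneg, ENNReal.ofReal_natCast,
    ENNReal.mul_div_mul_left _ _ (mod_cast n.factorial_ne_zero) (ENNReal.natCast_ne_top _)]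
  simp only [volHT, div_eq_mul_inv]
  exact lintegral_mul_const' _ _ (ENNReal.inv_ne_top.2 (ENNReal.ofReal_pos.2 (omega_pos n)).ne')

theorem normalizedVolHT_image (A : (Fin n → ℝ) ≃ₗ[ℝ] (Fin n → ℝ)) (K : Set (Fin n → ℝ))
    (hU : MeasurableSet U) : normalizedVolHT (A '' K) (A '' U) = normalizedVolHT K U := by
  rw [normalizedVolHT, setLIntegral_image_linearEquiv volume A hU,
    ← lintegral_const_mul' _ _ ENNReal.ofReal_ne_top]
  simp only [volume_polarAt_image, normalizedVolHT]

theorem normalizedVolHT_smul_image (A : (Fin n → ℝ) ≃ₗ[ℝ] (Fin n → ℝ)) (hK : MeasurableSet K)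
    (c : ℝ) : normalizedVolHT (A '' K) (c • A '' K) = normalizedVolHT K (c • K) := by
  rw [← image_smul_comm A c K fun x => map_smul A c x,
    normalizedVolHT_image A K (hK.const_smul₀ c)]

theorem normalizedVolHT_cartesianProduct {H V : Set (Fin m → ℝ)} (hH : IsBounded H)
    (hK : IsBounded K) (hVH : V ⊆ H) (hUK : U ⊆ K) (hV : MeasurableSet V) (hU : MeasurableSet U) :
    normalizedVolHT (cartesianProduct H K) (cartesianProduct V U) =
      normalizedVolHT H V * normalizedVolHT K U := by
  simp only [normalizedVolHT]
  rw [setLIntegral_cartesianProduct, ← lintegral_const_mul' _ _ (ENNReal.natCast_ne_top _),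
    setLIntegral_congr_fun (hV.prod hU) fun q hq =>
      factorial_mul_volume_polarAt_cartesianProduct hH hK (hVH hq.1) (hUK hq.2),
    Measure.volume_eq_prod, ← Measure.prod_restrict, lintegral_prod_mul
      ((measurable_volume_polarAt H).const_mul _).aemeasurable
      ((measurable_volume_polarAt K).const_mul _).aemeasurable,
    lintegral_const_mul' _ _ (ENNReal.natCast_ne_top _),
    lintegral_const_mul' _ _ (ENNReal.natCast_ne_top _)]

theorem smul_cartesianProduct {c : ℝ} (hc : c ≠ 0) (H : Set (Fin m → ℝ)) (K : Set (Fin n → ℝ)) :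
    c • cartesianProduct H K = cartesianProduct (c • H) (c • K) := by
  ext z
  simp only [cartesianProduct, mem_smul_set_iff_inv_smul_mem₀ hc, mem_ofPred_eq]
  rfl

namespace IsConvexBody

theorem normalizedVolHT_smul (hK : IsConvexBody K) {c : ℝ} (h0 : 0 < c) (h1 : c ≤ 1) :
    normalizedVolHT K (c • K) =
      ENNReal.ofReal (c ^ n) * ∫⁻ r in Ioi (0 : ℝ), ENNReal.ofReal (r ^ n * Real.exp (-r)) *
        ∫⁻ p in K, ∫⁻ w in polarAt K 0, ENNReal.ofReal (Real.exp (r * c * (w ⬝ᵥ p))) := by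
  have hker : Measurable fun q : ((Fin n → ℝ) × ℝ) × (Fin n → ℝ) =>
      ENNReal.ofReal (Real.exp (q.1.2 * c * (q.2 ⬝ᵥ q.1.1))) := by
    refine (Real.continuous_exp.comp ?_).measurable.ennreal_ofReal
    exact (continuous_fst.snd.mul continuous_const).mul
      (continuous_snd.dotProduct continuous_fst.fst)
  rw [normalizedVolHT, setLIntegral_smul_set volume h0 hK.measurableSet, Module.finrank_fin_fun,
    mul_left_comm, ← lintegral_const_mul' _ _ (ENNReal.natCast_ne_top _)]
  congr 1
  calc ∫⁻ p in K, n.factorial * volume (polarAt K (c • p))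
      = ∫⁻ p in K, ∫⁻ r in Ioi (0 : ℝ), ENNReal.ofReal (r ^ n * Real.exp (-r)) *
          ∫⁻ w in polarAt K 0, ENNReal.ofReal (Real.exp (r * c * (w ⬝ᵥ p))) := by
        refine setLIntegral_congr_fun hK.measurableSet fun p hp => ?_
        rw [factorial_mul_volume_polarAt_eq_slice hK.isCompact.isBounded hK.zero_mem
          (hK.smul_subset h0.le h1 (smul_mem_smul_set hp))]
        simp only [dotProduct_smul, smul_eq_mul, mul_assoc]
    _ = ∫⁻ r in Ioi (0 : ℝ), ∫⁻ p in K, ENNReal.ofReal (r ^ n * Real.exp (-r)) *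
          ∫⁻ w in polarAt K 0, ENNReal.ofReal (Real.exp (r * c * (w ⬝ᵥ p))) :=
        lintegral_lintegral_swap
          (Measurable.mul (by fun_prop) hker.lintegral_prod_right').aemeasurable
    _ = _ := lintegral_congr fun r => lintegral_const_mul' _ _ ENNReal.ofReal_ne_top

theorem normalizedVolHT_smul_polarAt (hK : IsConvexBody K) {c : ℝ} (h0 : 0 < c) (h1 : c ≤ 1) :
    normalizedVolHT (polarAt K 0) (c • polarAt K 0) = normalizedVolHT K (c • K) := by
  rw [hK.polarAt_zero.normalizedVolHT_smul h0 h1, hK.normalizedVolHT_smul h0 h1,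
    polarAt_polarAt_zero hK.convex hK.isCompact.isClosed hK.zero_mem]
  congr 1
  refine lintegral_congr fun r => ?_
  have hker : Measurable fun q : (Fin n → ℝ) × (Fin n → ℝ) =>
      ENNReal.ofReal (Real.exp (r * c * (q.2 ⬝ᵥ q.1))) :=
    (Real.continuous_exp.comp (continuous_const.mul
      (continuous_snd.dotProduct continuous_fst))).measurable.ennreal_ofReal
  rw [lintegral_lintegral_swap hker.aemeasurable]
  simp only [dotProduct_comm]

end IsConvexBody

end HolmesThompson

section LineSegment

theorem segment_neg_self_eq_image {v : Fin 1 → ℝ} (hv : v 0 ≠ 0) :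
    segment ℝ (-v) v =
      LinearEquiv.smulOfNeZero ℝ (Fin 1 → ℝ) (v 0) hv '' Metric.closedBall 0 1 := by
  ext x
  simp only [mem_image, mem_closedBall_zero_iff, pi_norm_le_iff_of_nonneg zero_le_one,
    Fin.forall_fin_one, Real.norm_eq_abs, abs_le, LinearEquiv.smulOfNeZero_apply]
  constructor
  · rintro ⟨a, b, ha, hb, hab, rfl⟩
    refine ⟨fun _ => b - a, ⟨by linarith, by linarith⟩, funext <| Fin.forall_fin_one.2 ?_⟩
    simp only [Pi.smul_apply, Pi.add_apply, Pi.neg_apply, smul_eq_mul]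
    ring
  · rintro ⟨y, ⟨hy₁, hy₂⟩, rfl⟩
    refine ⟨(1 - y 0) / 2, (1 + y 0) / 2, by linarith, by linarith, by ring,
      funext <| Fin.forall_fin_one.2 ?_⟩
    simp only [Pi.smul_apply, Pi.add_apply, Pi.neg_apply, smul_eq_mul]
    ring

theorem isConvexBody_closedBall (n : ℕ) :
    IsConvexBody (Metric.closedBall (0 : Fin n → ℝ) 1) where
  convex := convex_closedBall 0 1
  isCompact := isCompact_closedBall 0 1
  mem_nhds_zero := Metric.closedBall_mem_nhds 0 one_pos

theorem closedBall_eq_preimage_Icc {r : ℝ} (hr : 0 ≤ r) :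
    Metric.closedBall (0 : Fin 1 → ℝ) r =
      MeasurableEquiv.funUnique (Fin 1) ℝ ⁻¹' Icc (-r) r := by
  ext x
  simp [pi_norm_le_iff_of_nonneg hr, abs_le]

theorem volume_polarAt_closedBall {p : Fin 1 → ℝ} (h₁ : -1 < p 0) (h₂ : p 0 < 1) :
    volume (polarAt (Metric.closedBall (0 : Fin 1 → ℝ) 1) p) =
      ENNReal.ofReal ((1 - p 0)⁻¹ + (1 + p 0)⁻¹) := by
  have hpolar : polarAt (Metric.closedBall (0 : Fin 1 → ℝ) 1) p =
      Icc (fun _ => -(1 + p 0)⁻¹) (fun _ => (1 - p 0)⁻¹) := by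
    ext w
    have hmem : w ∈ polarAt (Metric.closedBall (0 : Fin 1 → ℝ) 1) p ↔
        w 0 * (-1 - p 0) ≤ 1 ∧ w 0 * (1 - p 0) ≤ 1 := by
      simp only [polarAt, mem_ofPred_eq, mem_closedBall_zero_iff,
        pi_norm_le_iff_of_nonneg zero_le_one, Fin.forall_fin_one, Real.norm_eq_abs, abs_le,
        dotProduct, Finset.univ_unique, Fin.default_eq_zero, Finset.sum_singleton, Pi.sub_apply]
      refine ⟨fun h => ⟨h (-1) (by simp), h 1 (by simp)⟩, ?_⟩
      rintro ⟨ha, hb⟩ x ⟨hx₁, hx₂⟩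
      rcases le_total 0 (w 0) with _ | _ <;> nlinarith
    rw [hmem, mem_Icc, Pi.le_def, Pi.le_def, Fin.forall_fin_one, Fin.forall_fin_one, neg_le,
      ← one_div, ← one_div, le_div_iff₀ (by linarith), le_div_iff₀ (by linarith)]
    constructor <;> rintro ⟨ha, hb⟩ <;> constructor <;> linarith
  rw [hpolar, Real.volume_Icc_pi]
  simp

theorem setLIntegral_Icc_inv_add_inv {c : ℝ} (h0 : 0 ≤ c) (h1 : c < 1) :
    ∫⁻ x in Icc (-c) c, ENNReal.ofReal ((1 - x)⁻¹ + (1 + x)⁻¹) =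
      ENNReal.ofReal (2 * Real.log ((1 + c) / (1 - c))) := by
  have hle : -c ≤ c := by linarith
  have hpos (x : ℝ) (hx : x ∈ Icc (-c) c) : 0 < 1 - x ∧ 0 < 1 + x :=
    ⟨by linarith [hx.2], by linarith [hx.1]⟩
  have hsub : ContinuousOn (fun x : ℝ => (1 - x)⁻¹) (Icc (-c) c) :=
    (by fun_prop : Continuous fun x : ℝ => 1 - x).continuousOn.inv₀ fun x hx => (hpos x hx).1.ne'
  have hadd : ContinuousOn (fun x : ℝ => (1 + x)⁻¹) (Icc (-c) c) :=
    (by fun_prop : Continuous fun x : ℝ => 1 + x).continuousOn.inv₀ fun x hx => (hpos x hx).2.ne'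
  have hnonneg : ∀ᵐ x ∂volume.restrict (Icc (-c) c), 0 ≤ (1 - x)⁻¹ + (1 + x)⁻¹ :=
    ae_restrict_of_forall_mem measurableSet_Icc fun x hx =>
      (add_pos (inv_pos.2 (hpos x hx).1) (inv_pos.2 (hpos x hx).2)).le
  rw [← ofReal_integral_eq_lintegral_ofReal (hsub.fun_add hadd).integrableOn_Icc hnonneg,
    integral_Icc_eq_integral_Ioc, ← intervalIntegral.integral_of_le hle,
    intervalIntegral.integral_add (hsub.intervalIntegrable_of_Icc hle)
      (hadd.intervalIntegrable_of_Icc hle),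
    intervalIntegral.integral_comp_sub_left (fun x : ℝ => x⁻¹) 1,
    intervalIntegral.integral_comp_add_left (fun x : ℝ => x⁻¹) 1, sub_neg_eq_add,
    ← sub_eq_add_neg, integral_inv_of_pos (by linarith) (by linarith), two_mul]

theorem normalizedVolHT_closedBall {c : ℝ} (h0 : 0 ≤ c) (h1 : c < 1) :
    normalizedVolHT (Metric.closedBall (0 : Fin 1 → ℝ) 1)
        (c • Metric.closedBall (0 : Fin 1 → ℝ) 1) =
      ENNReal.ofReal (2 * Real.log ((1 + c) / (1 - c))) := by
  rw [smul_unitClosedBall_of_nonneg h0, normalizedVolHT, Nat.factorial_one, Nat.cast_one, one_mul,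
    ← setLIntegral_Icc_inv_add_inv h0 h1,
    ← (volume_preserving_funUnique (Fin 1) ℝ).setLIntegral_comp_preimage_emb
      (MeasurableEquiv.measurableEmbedding _), ← closedBall_eq_preimage_Icc h0]
  refine setLIntegral_congr_fun Metric.isClosed_closedBall.measurableSet fun p hp => ?_
  rw [closedBall_eq_preimage_Icc h0] at hp
  obtain ⟨hp₁ : -c ≤ p 0, hp₂ : p 0 ≤ c⟩ := hp
  exact volume_polarAt_closedBall (by linarith) (by linarith)

end LineSegment

section Hanner

variable {n : ℕ} {H : Set (Fin n → ℝ)}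

namespace IsHanner

theorem isConvexBody (hH : IsHanner n H) : IsConvexBody H := by
  induction hH with
  | lineSegment v hv =>
    rw [segment_neg_self_eq_image (by simpa [funext_iff] using hv)]
    exact (isConvexBody_closedBall 1).image _
  | product _ _ ihH ihK => exact ihH.cartesianProduct ihK
  | polar _ ih => exact ih.polarAt_zero
  | linearImage A _ ih => exact ih.image A

theorem normalizedVolHT_smul (hH : IsHanner n H) {c : ℝ} (h0 : 0 < c) (h1 : c < 1) :
    normalizedVolHT H (c • H) = ENNReal.ofReal (2 * Real.log ((1 + c) / (1 - c))) ^ n := by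
  induction hH with
  | lineSegment v hv =>
    rw [segment_neg_self_eq_image (by simpa [funext_iff] using hv),
      normalizedVolHT_smul_image _ (isConvexBody_closedBall 1).measurableSet,
      normalizedVolHT_closedBall h0.le h1, pow_one]
  | product hH hK ihH ihK =>
    have hH := hH.isConvexBody
    have hK := hK.isConvexBody
    rw [smul_cartesianProduct h0.ne', normalizedVolHT_cartesianProduct hH.isCompact.isBounded
      hK.isCompact.isBounded (hH.smul_subset h0.le h1.le) (hK.smul_subset h0.le h1.le)
      (hH.measurableSet.const_smul₀ c) (hK.measurableSet.const_smul₀ c), ihH, ihK, pow_add]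
  | polar hH ih => rw [hH.isConvexBody.normalizedVolHT_smul_polarAt h0 h1.le, ih]
  | linearImage A hH ih => rw [normalizedVolHT_smul_image A hH.isConvexBody.measurableSet, ih]

theorem volHT_smul (hH : IsHanner n H) {c : ℝ} (h0 : 0 < c) (h1 : c < 1) :
    volHT H (c • H) = ENNReal.ofReal (2 ^ n / ((n.factorial : ℝ) * omega n) *
      (Real.log ((1 + c) / (1 - c))) ^ n) := by
  have hlog : 0 ≤ Real.log ((1 + c) / (1 - c)) :=
    Real.log_nonneg ((one_le_div (by linarith)).2 (by linarith))
  have hnorm : 0 < n.factorial * omega n := mul_pos (mod_cast n.factorial_pos) (omega_pos n)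
  rw [volHT_eq_normalizedVolHT_div, hH.normalizedVolHT_smul h0 h1,
    ← ENNReal.ofReal_pow (by positivity), ← ENNReal.ofReal_div_of_pos hnorm, mul_pow,
    mul_div_right_comm]

end IsHanner

end Hanner

section FunkBall

variable {n : ℕ} {K : Set (Fin n → ℝ)}

namespace IsConvexBody

theorem gauge_le_iff (hK : IsConvexBody K) {z : Fin n → ℝ} {r : ℝ} (hr : 0 < r) :
    gauge K z ≤ r ↔ z ∈ r • K := by
  rw [mem_smul_set_iff_inv_smul_mem₀ hr.ne', ← inv_mul_le_one₀ hr, ← smul_eq_mul,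
    ← gauge_smul_of_nonneg (inv_nonneg.2 hr.le),
    gauge_le_one_iff_mem_closure hK.convex hK.mem_nhds_zero, hK.isCompact.isClosed.closure_eq]

theorem exitTime_zero (hK : IsConvexBody K) {z : Fin n → ℝ} (hz : 0 < gauge K z) :
    exitTime K 0 z = (gauge K z)⁻¹ := by
  have hset : {t : ℝ | 0 < t ∧ 0 + t • z ∈ frontier K} = {(gauge K z)⁻¹} := by
    ext t
    rw [mem_ofPred_eq, mem_singleton_iff, zero_add,
      ← gauge_eq_one_iff_mem_frontier hK.convex hK.mem_nhds_zero]
    constructor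
    · rintro ⟨ht, h⟩
      rw [gauge_smul_of_nonneg ht.le, smul_eq_mul] at h
      exact eq_inv_of_mul_eq_one_left h
    · rintro rfl
      refine ⟨inv_pos.2 hz, ?_⟩
      rw [gauge_smul_of_nonneg (inv_nonneg.2 hz.le), smul_eq_mul, inv_mul_cancel₀ hz.ne']
  rw [exitTime, hset, csInf_singleton]

theorem funkDist_zero (hK : IsConvexBody K) (z : Fin n → ℝ) :
    funkDist K 0 z = -Real.log (1 - gauge K z) := by
  rcases eq_or_ne 0 z with rfl | hz
  · simp [funkDist]
  have hg : 0 < gauge K z := (gauge_pos (absorbent_nhds_zero hK.mem_nhds_zero)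
    (NormedSpace.isVonNBounded_of_isBounded ℝ hK.isCompact.isBounded)).2 hz.symm
  rw [funkDist, if_neg hz, sub_zero, hK.exitTime_zero hg, ← Real.log_inv]
  congr 1
  field_simp

theorem funkBall_zero (hK : IsConvexBody K) {R : ℝ} (hR : 0 < R) :
    funkBall K 0 R = (1 - Real.exp (-R)) • K := by
  have hexp : Real.exp (-R) < 1 := Real.exp_lt_one_iff.2 (neg_lt_zero.2 hR)
  ext z
  rw [← hK.gauge_le_iff (sub_pos.2 hexp), funkBall, mem_ofPred_eq, hK.funkDist_zero,
    ← gauge_lt_one_iff_mem_interior hK.convex hK.mem_nhds_zero, le_sub_comm, neg_le]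
  constructor
  · rintro ⟨hlt, hlog⟩
    exact (Real.le_log_iff_exp_le (sub_pos.2 hlt)).1 hlog
  · intro hle
    have hpos : 0 < 1 - gauge K z := (Real.exp_pos (-R)).trans_le hle
    exact ⟨sub_pos.1 hpos, (Real.le_log_iff_exp_le hpos).2 hle⟩

end IsConvexBody

end FunkBall

end Funk

theorem lemma3p4 (n : ℕ) (H : Set (Fin n → ℝ)) (hH : Funk.IsHanner n H)
    (R : ℝ) (hR : 0 < R) (lam : ℝ) (hlam : lam = 1 - Real.exp (-R)) :
    Funk.volHT H (Funk.funkBall H 0 R) =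
        ENNReal.ofReal (2 ^ n / ((n.factorial : ℝ) * Funk.omega n) *
          (Real.log ((1 + lam) / (1 - lam))) ^ n) ∧
      Funk.volHT H (Funk.funkBall H 0 R) =
        ENNReal.ofReal (2 ^ n / ((n.factorial : ℝ) * Funk.omega n) *
          (Real.log (2 * Real.exp R - 1)) ^ n) := by
  have hpos : 0 < lam := hlam ▸ sub_pos.2 (Real.exp_lt_one_iff.2 (neg_lt_zero.2 hR))
  have hlt : lam < 1 := hlam ▸ sub_lt_self 1 (Real.exp_pos (-R))
  have hratio : (1 + lam) / (1 - lam) = 2 * Real.exp R - 1 := by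
    rw [hlam, Real.exp_neg]
    field_simp
    ring
  have hvol : Funk.volHT H (Funk.funkBall H 0 R) =
      ENNReal.ofReal (2 ^ n / ((n.factorial : ℝ) * Funk.omega n) *
        (Real.log ((1 + lam) / (1 - lam))) ^ n) := by
    rw [hH.isConvexBody.funkBall_zero hR, ← hlam, hH.volHT_smul hpos hlt]
  exact ⟨hvol, hratio ▸ hvol⟩
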